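/- **Conventions.** A variety of Heyting algebras is a class of Heyting algebras axiomatized by a set of equations; $\mathbb V(A)$ is the least variety containing $A$. A variety $\mathsf K$ is regarded as a category whose morphisms are all Heyting homomorphisms between its members; it has the *ES property* if every epimorphism of this category is surjective. An *Esakia space* is a compact Hausdorff space with a basis of clopen sets, equipped with a partial order such that ${\uparrow}x$ is closed for every point $x$ and ${\downarrow}U$ is clopen for every clopen $U$. Esakia morphisms are the continuous order-preserving maps $f\colon X\to Y$ such that $f(x)\le y$ implies $y=f(z)$ for some $z\ge x$. The dual $A_*$ of a Heyting algebra $A$ is the set of its non-empty proper prime filters, ordered by inclusion, with the topology that has as a subbasis the sets $\{F : a\in F\}$ and $\{F : a\notin F\}$ ($a\in A$). The dual $X^*$ of an Esakia space $X$ is the Heyting algebra of its clopen upsets under inclusion, with $U\to V = X\smallsetminus{\downarrow}(U\smallsetminus V)$. For a variety $\mathsf K$, the dual class $\mathsf K_*$ consists of all Esakia spaces isomorphic (via mutually inverse Esakia morphisms) to $A_*$ for some $A\in\mathsf K$. A poset has *width at most $n$* if no set ${\uparrow}x$ contains an antichain of $n+1$ elements; a Heyting algebra $A$ has width at most $n$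 if $A_*$ does, and $\mathsf W_n$ is the class of all Heyting algebras of width at most $n$. For $n>1$ let $X_n$ be the set of $2n$ distinct points $a_1,\dots,a_n,b_1,\dots,b_n$ with the discrete topology and the partial order in which $x\le y$ iff $x=y$, or $x=a_1$ and $y\in\{b_2,\dots,b_n\}$, or $x=a_m$ for some $m>1$ and $y\in\{b_1,b_m\}$. Let $X_n^\infty$ be the disjoint union of copies $X_n^{(k)}$ ($k\in\mathbb N$) of $X_n$ and a point $\top$. It is ordered so that $\top$ is the maximum, each copy keeps its order, and every element of $X_n^{(k)}$ is below every element of $X_n^{(m)}$ whenever $k<m$. A subset $U$ of $X_n^\infty$ is open iff $\top\notin U$ or there is $k$ with $\bigcup_{m\ge k}X_n^{(m)}\subseteq U$. Then $X_n^\infty$ is an Esakia space. **Statement.** Let $n>1$ be an integer. 1. If $\mathsf K$ is a variety of Heyting algebras all of whose members have width at most $n$, and $X_n^\infty\in\mathsf K_*$, then $\mathsf K$ lacks the ES property. 2. $\mathsf W_n$ is a variety, $\mathbb V((X_n^\infty)^*)\subseteq\mathsf W_n$, and every variety $\mathsf K$ with $\mathbb V((X_n^\infty)^*)\subseteq\mathsf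 K\subseteq\mathsf W_n$ lacks the ES property. In particular, $\mathsf W_n$ lacks the ES property, i.e., there is a non-surjective epimorphism in $\mathsf W_n$. -/

import Mathlib

open CategoryTheory

universe u v

namespace HeytES

/-! ### Varieties of Heyting algebras -/

/-- Terms in the signature of Heyting algebras, with variables from `V`. -/
inductive HeytingTerm (V : Type v) : Type v
  | var (x : V) : HeytingTerm V
  | bot : HeytingTerm V
  | top : HeytingTerm V
  | inf (s t : HeytingTerm V) : HeytingTerm V
  | sup (s t : HeytingTerm V) : HeytingTerm V
  | imp (s t : HeytingTerm V) : HeytingTerm V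

/-- The value of a term under an assignment of its variables in a Heyting algebra. -/
def HeytingTerm.eval {V : Type v} {A : Type u} [HeytingAlgebra A] (e : V → A) :
    HeytingTerm V → A
  | .var x => e x
  | .bot => ⊥
  | .top => ⊤
  | .inf s t => s.eval e ⊓ t.eval e
  | .sup s t => s.eval e ⊔ t.eval e
  | .imp s t => s.eval e ⇨ t.eval e

/-- `A` satisfies the equation `p.1 ≈ p.2`. -/
def Satisfies (A : Type u) [HeytingAlgebra A] (p : HeytingTerm ℕ × HeytingTerm ℕ) : Prop :=
  ∀ e : ℕ → A, p.1.eval e = p.2.eval e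

/-- A variety of Heyting algebras: the class of all models of some set of equations. -/
def IsVariety (K : ObjectProperty HeytAlg.{u}) : Prop :=
  ∃ E : Set (HeytingTerm ℕ × HeytingTerm ℕ), ∀ A : HeytAlg.{u}, K A ↔ ∀ p ∈ E, Satisfies A p

/-- The variety generated by a Heyting algebra `A`: the least variety containing `A`. -/
def varietyGeneratedBy (A : HeytAlg.{u}) : ObjectProperty HeytAlg.{u} :=
  fun B => ∀ K : ObjectProperty HeytAlg.{u}, IsVariety K → K A → K B

/-- The epimorphism surjectivity property of a class of Heyting algebras, regarded as a category
with all Heyting homomorphisms between its members: every epimorphism is surjective. -/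
def HasES (K : ObjectProperty HeytAlg.{u}) : Prop :=
  ∀ (A B : K.FullSubcategory) (f : A ⟶ B), Epi f → Function.Surjective f.hom

/-! ### Esakia spaces and the dual of a Heyting algebra -/

/-- Esakia spaces: a Stone space (compact, Hausdorff, with a basis of clopen sets) with a partial
order such that principal upsets are closed and downsets of clopen sets are clopen. -/
class EsakiaSpace (X : Type u) [TopologicalSpace X] [PartialOrder X] : Prop
    extends CompactSpace X, T2Space X where
  basis_clopen : TopologicalSpace.IsTopologicalBasis {U : Set X | IsClopen U}
  isClosed_upset : ∀ x : X, IsClosed (Set.Ici x)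
  isClopen_downset : ∀ U : Set X, IsClopen U → IsClopen {x : X | ∃ y ∈ U, x ≤ y}

/-- Two ordered topological spaces are isomorphic in the category of Esakia morphisms. -/
def EsakiaIsomorphic (X : Type u) (Y : Type v) [TopologicalSpace X] [PartialOrder X]
    [TopologicalSpace Y] [PartialOrder Y] : Prop :=
  ∃ (f : EsakiaHom X Y) (g : EsakiaHom Y X),
    g.comp f = EsakiaHom.id X ∧ f.comp g = EsakiaHom.id Y

/-- The set of (non-empty, proper) prime filters of a Heyting algebra, ordered by inclusion. -/
abbrev DualSpace (A : Type u) [HeytingAlgebra A] : Type u :=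
  {F : Order.PFilter A // F.IsPrime}

/-- The topology of the dual space, with subbasis the sets of prime filters containing `a`, and
their complements. -/
instance (A : Type u) [HeytingAlgebra A] : TopologicalSpace (DualSpace A) :=
  TopologicalSpace.generateFrom
    ({U | ∃ a : A, U = {F | a ∈ F.1}} ∪ {U | ∃ a : A, U = {F | a ∉ F.1}})

/-- `X` belongs to the dual class of `K`, i.e. `X` is isomorphic to the dual space of a member
of `K`. -/
def InDualClass (K : ObjectProperty HeytAlg.{u}) (X : Type v) [TopologicalSpace X]
    [PartialOrder X] [EsakiaSpace X] : Prop :=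
  ∃ A : HeytAlg.{u}, K A ∧ EsakiaIsomorphic (DualSpace A) X

/-- The Heyting algebra of clopen upsets of an Esakia space, where `U ⇨ V` is the complement of the
downset generated by `U \ V`. -/
instance (X : Type u) [TopologicalSpace X] [PartialOrder X] [EsakiaSpace X] :
    HeytingAlgebra (ClopenUpperSet X) :=
  { (inferInstance : Lattice (ClopenUpperSet X)),
    (inferInstance : BoundedOrder (ClopenUpperSet X)) with
    himp := fun U V =>
      { carrier := {x | ∃ y ∈ (U : Set X) \ V, x ≤ y}ᶜ
        isClopen' := (EsakiaSpace.isClopen_downset _ (U.isClopen.diff V.isClopen)).compl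
        upper' := fun _ _ hxy hx ⟨z, hz, hyz⟩ => hx ⟨z, hz, hxy.trans hyz⟩ }
    compl := fun U =>
      { carrier := {x | ∃ y ∈ (U : Set X) \ (⊥ : ClopenUpperSet X), x ≤ y}ᶜ
        isClopen' := (EsakiaSpace.isClopen_downset _
          (U.isClopen.diff (⊥ : ClopenUpperSet X).isClopen)).compl
        upper' := fun _ _ hxy hx ⟨z, hz, hyz⟩ => hx ⟨z, hz, hxy.trans hyz⟩ }
    le_himp_iff := by
      intro W U V
      constructor
      · rintro h x ⟨hxW, hxU⟩
        by_contra hxV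
        exact h hxW ⟨x, ⟨hxU, hxV⟩, le_rfl⟩
      · rintro h x hxW ⟨y, ⟨hyU, hyV⟩, hxy⟩
        exact hyV (h ⟨W.upper hxy hxW, hyU⟩)
    himp_bot := fun _ => rfl }

/-- The Heyting algebra dual to an Esakia space. -/
abbrev dualAlgebra (X : Type u) [TopologicalSpace X] [PartialOrder X] [EsakiaSpace X] :
    HeytAlg.{u} :=
  HeytAlg.of (ClopenUpperSet X)

/-! ### Width -/

/-- A poset has width at most `n` if no principal upset contains an antichain of `n + 1`
elements. -/
def WidthAtMost (n : ℕ) (X : Type u) [PartialOrder X] : Prop :=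
  ∀ x : X, ¬ ∃ S : Finset X, S.card = n + 1 ∧ (∀ y ∈ S, x ≤ y) ∧
    IsAntichain (· ≤ ·) (S : Set X)

/-- The class of all Heyting algebras of width at most `n`, i.e. whose dual space has width at
most `n`. -/
def W (n : ℕ) : ObjectProperty HeytAlg.{u} :=
  fun A => WidthAtMost n (DualSpace A)

/-! ### Infinite sums of Esakia spaces -/

/-- The universe of the sum of a sequence of posets: the disjoint union together with a new
element. -/
inductive InfSum (X : ℕ → Type u) : Type u
  | pt (k : ℕ) (x : X k) : InfSum X
  | top : InfSum X

namespace InfSum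

variable {X : ℕ → Type u}

/-- The order of the sum: each summand is placed above the previous ones, and the new element is
the maximum. -/
inductive Le [∀ k, PartialOrder (X k)] : InfSum X → InfSum X → Prop
  | le_top (p : InfSum X) : Le p .top
  | same (k : ℕ) (x y : X k) (h : x ≤ y) : Le (.pt k x) (.pt k y)
  | lt (k m : ℕ) (x : X k) (y : X m) (h : k < m) : Le (.pt k x) (.pt m y)

instance [∀ k, PartialOrder (X k)] : PartialOrder (InfSum X) where
  le := Le
  le_refl p := by
    cases p with
    | pt k x => exact .same k x x le_rfl
    | top => exact .le_top _
  le_trans p q r hpq hqr := by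
    cases hqr with
    | le_top => exact .le_top _
    | same k x y h =>
      cases hpq with
      | same _ z _ h' => exact .same _ _ _ (h'.trans h)
      | lt j _ z _ h' => exact .lt _ _ _ _ h'
    | lt k m x y h =>
      cases hpq with
      | same _ z _ h' => exact .lt _ _ _ _ h
      | lt j _ z _ h' => exact .lt _ _ _ _ (h'.trans h)
  le_antisymm p q hpq hqp := by
    cases hpq with
    | le_top => cases hqp; rfl
    | same k x y h =>
      cases hqp with
      | same _ _ _ h' => rw [le_antisymm h h']
      | lt _ _ _ _ h' => exact absurd h' (lt_irrefl _)
    | lt k m x y h =>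
      cases hqp with
      | same _ _ _ h' => exact absurd h (lt_irrefl _)
      | lt _ _ _ _ h' => exact absurd h (lt_asymm h')

/-- The topology of the sum: `U` is open if its trace on each summand is open and, in case it
contains the new element, it contains all summands from some index on. -/
instance [∀ k, TopologicalSpace (X k)] : TopologicalSpace (InfSum X) where
  IsOpen U := (∀ k, IsOpen {x : X k | pt k x ∈ U}) ∧
    (top ∈ U → ∃ k, ∀ m, k ≤ m → ∀ x : X m, pt m x ∈ U)
  isOpen_univ := ⟨fun _ => by simp, fun _ => ⟨0, fun _ _ _ => trivial⟩⟩
  isOpen_inter U V hU hV := by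
    refine ⟨fun k => (hU.1 k).inter (hV.1 k), fun ⟨h1, h2⟩ => ?_⟩
    obtain ⟨k, hk⟩ := hU.2 h1
    obtain ⟨l, hl⟩ := hV.2 h2
    exact ⟨max k l, fun m hm x =>
      ⟨hk m ((le_max_left _ _).trans hm) x, hl m ((le_max_right _ _).trans hm) x⟩⟩
  isOpen_sUnion S hS := by
    refine ⟨fun k => ?_, ?_⟩
    · have : {x : X k | pt k x ∈ ⋃₀ S} = ⋃ U ∈ S, {x : X k | pt k x ∈ U} := by
        ext x; simp
      rw [this]
      exact isOpen_biUnion fun U hU => (hS U hU).1 k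
    · rintro ⟨U, hU, h⟩
      obtain ⟨k, hk⟩ := (hS U hU).2 h
      exact ⟨k, fun m hm x => ⟨U, hU, hk m hm x⟩⟩

theorem le_def [∀ k, PartialOrder (X k)] {p q : InfSum X} : p ≤ q ↔ Le p q := Iff.rfl

theorem isOpen_def [∀ k, TopologicalSpace (X k)] {U : Set (InfSum X)} :
    IsOpen U ↔ (∀ k, IsOpen {x : X k | pt k x ∈ U}) ∧
      (top ∈ U → ∃ k, ∀ m, k ≤ m → ∀ x : X m, pt m x ∈ U) := Iff.rfl

theorem isClopen_image_pt [∀ k, TopologicalSpace (X k)] (k : ℕ) {U : Set (X k)}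
    (hU : IsClopen U) : IsClopen (pt k '' U : Set (InfSum X)) := by
  refine ⟨⟨isOpen_def.2 ⟨fun m => ?_, fun _ => ⟨k + 1, fun m hm x => ?_⟩⟩⟩,
    isOpen_def.2 ⟨fun m => ?_, fun h => ?_⟩⟩
  · by_cases h : m = k
    · subst h
      convert hU.compl.isOpen using 1
      ext x; simp
    · convert isOpen_univ using 1
      ext x
      simp only [Set.mem_compl_iff, Set.mem_image, Set.mem_ofPred_eq, Set.mem_univ, iff_true]
      rintro ⟨y, -, hy⟩
      cases hy; exact h rfl
  · rintro ⟨y, -, hy⟩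
    cases hy; omega
  · by_cases h : m = k
    · subst h
      convert hU.isOpen using 1
      ext x; simp
    · convert isOpen_empty using 1
      ext x
      simp only [Set.mem_image, Set.mem_ofPred_eq, Set.mem_empty_iff_false, iff_false]
      rintro ⟨y, -, hy⟩
      cases hy; exact h rfl
  · obtain ⟨y, -, hy⟩ := h
    cases hy

/-- The tail of the sum from index `k` on. -/
theorem isClopen_tail [∀ k, TopologicalSpace (X k)] (k : ℕ) :
    IsClopen ({p | ∀ m x, p = pt m x → k ≤ m} : Set (InfSum X)) := by
  refine ⟨⟨isOpen_def.2 ⟨fun m => ?_, fun h => ?_⟩⟩,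
    isOpen_def.2 ⟨fun m => ?_, fun _ => ⟨k, fun m hm x => ?_⟩⟩⟩
  · by_cases h : k ≤ m
    · convert isOpen_empty using 1
      ext x
      simp only [Set.mem_compl_iff, Set.mem_ofPred_eq, Set.mem_empty_iff_false, iff_false, not_not]
      rintro _ _ hy
      cases hy; exact h
    · convert isOpen_univ using 1
      ext x
      simp only [Set.mem_compl_iff, Set.mem_ofPred_eq, Set.mem_univ, iff_true]
      exact fun h' => h (h' _ _ rfl)
  · exact absurd (fun m x hx => by cases hx) h
  · by_cases h : k ≤ m
    · convert isOpen_univ using 1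
      ext x
      simp only [Set.mem_ofPred_eq, Set.mem_univ, iff_true]
      rintro _ _ hy
      cases hy; exact h
    · convert isOpen_empty using 1
      ext x
      simp only [Set.mem_ofPred_eq, Set.mem_empty_iff_false, iff_false]
      exact fun h' => h (h' _ _ rfl)
  · rintro _ _ hy
    cases hy; exact hm

theorem continuous_pt [∀ k, TopologicalSpace (X k)] (k : ℕ) :
    Continuous (pt k : X k → InfSum X) :=
  ⟨fun _ hU => hU.1 k⟩

theorem basis [∀ k, TopologicalSpace (X k)] [∀ k, PartialOrder (X k)] [∀ k, EsakiaSpace (X k)] :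
    TopologicalSpace.IsTopologicalBasis {U : Set (InfSum X) | IsClopen U} := by
  refine TopologicalSpace.isTopologicalBasis_of_isOpen_of_nhds (fun U hU => hU.isOpen) ?_
  rintro (⟨k, x⟩ | _) U hp hU
  · obtain ⟨V, hV, hxV, hVU⟩ :=
      (EsakiaSpace.basis_clopen (X := X k)).exists_subset_of_mem_open hp (hU.1 k)
    refine ⟨_, isClopen_image_pt k hV, ⟨x, hxV, rfl⟩, ?_⟩
    rintro _ ⟨y, hy, rfl⟩
    exact hVU hy
  · obtain ⟨k, hk⟩ := hU.2 hp
    refine ⟨_, isClopen_tail k, fun _ _ hx => InfSum.noConfusion rfl (heq_of_eq hx), ?_⟩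
    rintro (⟨m, x⟩ | _) h
    · exact hk m (h m x rfl) x
    · exact hp

/-- The sum of a sequence of Esakia spaces is an Esakia space. -/
instance [∀ k, TopologicalSpace (X k)] [∀ k, PartialOrder (X k)] [∀ k, EsakiaSpace (X k)] :
    EsakiaSpace (InfSum X) where
  isCompact_univ := by
    rw [isCompact_iff_finite_subcover]
    intro ι U hU hcov
    obtain ⟨i, hi⟩ := Set.mem_iUnion.1 (hcov (Set.mem_univ top))
    obtain ⟨k, hk⟩ := (hU i).2 hi
    have hc : IsCompact (⋃ m ∈ Finset.range k, Set.range (pt m : X m → InfSum X)) :=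
      (Finset.range k).isCompact_biUnion fun m _ => isCompact_range (continuous_pt m)
    obtain ⟨t, ht⟩ := hc.elim_finite_subcover U hU (fun p _ => hcov (Set.mem_univ p))
    classical
    refine ⟨insert i t, ?_⟩
    rintro (⟨m, x⟩ | _) -
    · by_cases h : k ≤ m
      · exact Set.mem_biUnion (Finset.mem_insert_self i t) (hk m h x)
      · have := ht (Set.mem_biUnion (Finset.mem_coe.2 (Finset.mem_range.2 (not_le.1 h)))
          (Set.mem_range_self x))
        obtain ⟨j, hj, hx⟩ := Set.mem_iUnion₂.1 this
        exact Set.mem_biUnion (Finset.mem_insert_of_mem hj) hx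
    · exact Set.mem_biUnion (Finset.mem_insert_self i t) hi
  t2 := by
    have key : ∀ p q : InfSum X, p ≠ q → ∃ U : Set (InfSum X), IsClopen U ∧ (p ∈ U ↔ q ∉ U) := by
      have aux : ∀ k (x : X k), ∃ U : Set (InfSum X), IsClopen U ∧ (pt k x ∈ U ↔ top ∉ U) := by
        intro k x
        refine ⟨_, isClopen_image_pt k isClopen_univ, ?_⟩
        simp
      rintro (⟨k, x⟩ | _) (⟨m, y⟩ | _) hpq
      · by_cases h : k = m
        · subst h
          have hxy : x ≠ y := fun h => hpq (h ▸ rfl)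
          obtain ⟨V, hV, hxV, hVU⟩ := (EsakiaSpace.basis_clopen
            (X := X k)).exists_subset_of_mem_open (a := x) (u := {y}ᶜ) hxy isOpen_compl_singleton
          refine ⟨_, isClopen_image_pt k hV, ?_⟩
          have : y ∉ V := fun h => hVU h rfl
          simp [hxV, this]
        · refine ⟨_, isClopen_image_pt k isClopen_univ, ?_⟩
          have : ∀ z, (pt k z : InfSum X) ≠ pt m y := fun z hz => by cases hz; exact h rfl
          simp [this]
      · exact aux k x
      · obtain ⟨U, hU, h⟩ := aux m y
        exact ⟨U, hU, by tauto⟩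
      · exact absurd rfl hpq
    intro p q hpq
    obtain ⟨U, hU, h⟩ := key p q hpq
    by_cases hp : p ∈ U
    · exact ⟨U, Uᶜ, hU.isOpen, hU.compl.isOpen, hp, h.1 hp, disjoint_compl_right⟩
    · exact ⟨Uᶜ, U, hU.compl.isOpen, hU.isOpen, hp, by tauto, disjoint_compl_left⟩
  basis_clopen := basis
  isClosed_upset := by
    rintro (⟨k, x⟩ | _)
    · refine ⟨isOpen_def.2 ⟨fun m => ?_, fun h => absurd (Le.le_top _) h⟩⟩
      rcases lt_trichotomy m k with h | h | h
      · convert isOpen_univ using 1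
        ext y
        simp only [Set.mem_compl_iff, Set.mem_Ici, Set.mem_ofPred_eq, Set.mem_univ, iff_true]
        intro hle
        cases hle <;> omega
      · subst h
        convert (EsakiaSpace.isClosed_upset x).isOpen_compl using 1
        ext y
        simp only [Set.mem_compl_iff, Set.mem_Ici, Set.mem_ofPred_eq]
        refine not_congr ⟨fun hle => ?_, fun hle => Le.same _ _ _ hle⟩
        cases hle with
        | same _ _ _ h => exact h
        | lt _ _ _ _ h => exact absurd h (lt_irrefl _)
      · convert isOpen_empty using 1
        ext y
        simp only [Set.mem_compl_iff, Set.mem_Ici, Set.mem_ofPred_eq, Set.mem_empty_iff_false,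
          iff_false, not_not]
        exact Le.lt _ _ _ _ h
    · have : (Set.Ici top : Set (InfSum X)) =
          ⋂ k, {p | ∀ m x, p = pt m x → k ≤ m} := by
        ext p
        simp only [Set.mem_Ici, Set.mem_iInter, Set.mem_ofPred_eq]
        constructor
        · intro h
          cases h
          rintro _ _ _ h
          cases h
        · intro h
          cases p with
          | pt m x => exact absurd (h (m + 1) m x rfl) (by omega)
          | top => exact le_rfl
      rw [this]
      exact isClosed_iInter fun k => (isClopen_tail k).isClosed
  isClopen_downset := by
    intro U hU
    by_cases htop : top ∈ U
    · convert isClopen_univ using 1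
      ext p
      simp only [Set.mem_ofPred_eq, Set.mem_univ, iff_true]
      exact ⟨_, htop, Le.le_top p⟩
    · obtain ⟨N, hN⟩ := hU.compl.isOpen.2 htop
      have hclopen : ∀ k, IsClopen {x : X k | ∃ q ∈ U, pt k x ≤ q} := by
        intro k
        by_cases h : ∃ m, k < m ∧ ∃ y : X m, pt m y ∈ U
        · obtain ⟨m, hm, y, hy⟩ := h
          convert isClopen_univ using 1
          ext x
          simp only [Set.mem_ofPred_eq, Set.mem_univ, iff_true]
          exact ⟨_, hy, Le.lt _ _ _ _ hm⟩
        · have hUk : IsClopen {x : X k | pt k x ∈ U} := hU.preimage (continuous_pt k)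
          convert EsakiaSpace.isClopen_downset _ hUk using 1
          ext x
          constructor
          · rintro ⟨q, hq, hle⟩
            cases hle with
            | le_top => exact absurd hq htop
            | same _ _ y hxy => exact ⟨y, hq, hxy⟩
            | lt _ m _ y hm => exact absurd ⟨m, hm, y, hq⟩ h
          · rintro ⟨y, hy, hxy⟩
            exact ⟨_, hy, Le.same _ _ _ hxy⟩
      refine ⟨⟨isOpen_def.2 ⟨fun k => (hclopen k).compl.isOpen, fun _ => ⟨N, ?_⟩⟩⟩,
        isOpen_def.2 ⟨fun k => (hclopen k).isOpen, ?_⟩⟩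
      · rintro m hm x ⟨q, hq, hle⟩
        cases hle with
        | le_top => exact htop hq
        | same _ _ y _ => exact hN m hm y hq
        | lt _ l _ y hl => exact hN l (hm.trans hl.le) y hq
      · rintro ⟨q, hq, hle⟩
        cases hle
        exact absurd hq htop

end InfSum

/-! ### The spaces `X_n` and `X_n^∞` -/

/-- The poset `X_n` has elements `a_1, …, a_n, b_1, …, b_n`. The element `a_(i+1)` is `a i`, and
`b_(i+1)` is `b i`, for `i = 0, …, n - 1`. -/
inductive Xn (n : ℕ) : Type u
  | a (i : Fin n) : Xn n
  | b (i : Fin n) : Xn n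

namespace Xn

/-- Besides the reflexive pairs, `a_1` is below `b_2, …, b_n`, and `a_m` is below `b_1` and `b_m`
for `m > 1`. -/
inductive Le {n : ℕ} : Xn.{u} n → Xn.{u} n → Prop
  | refl (x : Xn n) : Le x x
  | first (i j : Fin n) (hi : i.val = 0) (hj : j.val ≠ 0) : Le (.a i) (.b j)
  | later (i j : Fin n) (hi : i.val ≠ 0) (hj : j.val = 0 ∨ j = i) : Le (.a i) (.b j)

instance (n : ℕ) : PartialOrder (Xn.{u} n) where
  le := Le
  le_refl := .refl
  le_trans x y z hxy hyz := by
    cases hxy with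
    | refl => exact hyz
    | first i j hi hj => cases hyz; exact .first i j hi hj
    | later i j hi hj => cases hyz; exact .later i j hi hj
  le_antisymm x y hxy hyx := by
    cases hxy with
    | refl => rfl
    | first => cases hyx
    | later => cases hyx

/-- `X_n` carries the discrete topology. -/
instance (n : ℕ) : TopologicalSpace (Xn.{u} n) := ⊥

instance (n : ℕ) : DiscreteTopology (Xn.{u} n) := ⟨rfl⟩

instance (n : ℕ) : Finite (Xn.{u} n) :=
  Finite.of_surjective (fun s : Fin n ⊕ Fin n => Sum.elim a b s)
    (by rintro (i | i); exacts [⟨.inl i, rfl⟩, ⟨.inr i, rfl⟩])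

instance (n : ℕ) : EsakiaSpace (Xn.{u} n) where
  basis_clopen := TopologicalSpace.isTopologicalBasis_of_isOpen_of_nhds
    (fun _ hU => hU.isOpen) fun x U hx _ => ⟨U, isClopen_discrete U, hx, subset_rfl⟩
  isClosed_upset _ := isClosed_discrete _
  isClopen_downset _ _ := isClopen_discrete _

end Xn

/-- The Esakia space `X_n^∞`, the sum of countably many copies of `X_n`. -/
abbrev XnInf (n : ℕ) : Type u := InfSum (fun _ : ℕ => Xn.{u} n)

end HeytES

namespace HeytES

/-! ### Prime filters and Esakia duality. -/

namespace DualSpace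

section Basic

variable {A : Type u} [HeytingAlgebra A]

/-! Let `A` be a member of `K` dual to `X_n^∞`. Glue `b_1` of each copy to `a_1` of the next, and
`a_m` to `b_m` within each copy for `m > 1`. The elements of `A` whose clopen upsets respect this
gluing form a proper subalgebra `B` (`exists_saturated_subalgebra`, `exists_not_saturated`), which
lies in `K` because varieties are closed under subalgebras. The inclusion of `B` in `A` is the
non-surjective epimorphism.

To see that it is epic, let two homomorphisms from `A` to `C` agree on `B`. Dually they are bounded
morphisms `G`, `H` from the prime filters of `C` to `X_n^∞`. Saturated clopen upsets separate points
that are neither equal nor glued (`related_of_forall_saturated`), so `G z` and `H z` are always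
equal or glued. If they were glued somewhere, the back condition would carry the discrepancy upwards
through the copies and yield `n + 1` pairwise incomparable points above a single one
(`not_shift_of_width`), against the width of `C`. Hence `G = H`, and the two homomorphisms coincide.

That the class of algebras of width at most `n` is a variety follows from a single equation that
defines it (`satisfies_width_iff`). It contains the dual of `X_n^∞` because that space is a union of
`n` chains. -/

theorem bot_notMem (F : DualSpace A) : ⊥ ∉ F.1 := by
  intro h
  obtain ⟨x, hx⟩ := F.2.compl_ideal.Nonempty
  exact hx (Order.PFilter.mem_of_le bot_le h)

theorem sup_mem_iff (F : DualSpace A) {a b : A} : a ⊔ b ∈ F.1 ↔ a ∈ F.1 ∨ b ∈ F.1 := by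
  refine ⟨fun h => ?_, ?_⟩
  · by_contra hab
    push Not at hab
    obtain ⟨z, hz, haz, hbz⟩ := F.2.compl_ideal.Directed a hab.1 b hab.2
    exact hz (Order.PFilter.mem_of_le (sup_le haz hbz) h)
  · rintro (h | h)
    exacts [Order.PFilter.mem_of_le le_sup_left h, Order.PFilter.mem_of_le le_sup_right h]

theorem inf_mem_iff (F : DualSpace A) {a b : A} : a ⊓ b ∈ F.1 ↔ a ∈ F.1 ∧ b ∈ F.1 :=
  Order.PFilter.inf_mem_iff

theorem le_iff {F G : DualSpace A} : F ≤ G ↔ ∀ a, a ∈ F.1 → a ∈ G.1 := Iff.rfl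

theorem eq_of_mem_iff {F G : DualSpace A} (h : ∀ a, a ∈ F.1 ↔ a ∈ G.1) : F = G :=
  le_antisymm (fun a => (h a).1) (fun a => (h a).2)

/-- A prime filter from its underlying set. -/
def ofSet (S : Set A) (htop : ⊤ ∈ S) (hbot : ⊥ ∉ S) (hle : ∀ a b, a ≤ b → a ∈ S → b ∈ S)
    (hinf : ∀ a b, a ∈ S → b ∈ S → a ⊓ b ∈ S) (hsup : ∀ a b, a ⊔ b ∈ S → a ∈ S ∨ b ∈ S) :
    DualSpace A :=
  ⟨(Order.IsPFilter.of_def (F := S) ⟨⊤, htop⟩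
      (fun a ha b hb => ⟨a ⊓ b, hinf a b ha hb, inf_le_left, inf_le_right⟩)
      (fun {a b} h ha => hle a b h ha)).toPFilter,
    ⟨fun a b hba ha hb => ha (hle b a hba hb), ⟨⊥, hbot⟩, fun a ha b hb =>
      ⟨a ⊔ b, fun h => (hsup a b h).elim ha hb, le_sup_left, le_sup_right⟩⟩⟩

/-- The prime filter theorem: a filter disjoint from an ideal extends to a prime filter that is
still disjoint from the ideal. -/
theorem exists_of_disjoint (S T : Set A) (hS : S.Nonempty) (hT : T.Nonempty)
    (hSle : ∀ a b, a ≤ b → a ∈ S → b ∈ S) (hSinf : ∀ a b, a ∈ S → b ∈ S → a ⊓ b ∈ S)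
    (hTle : ∀ a b, a ≤ b → b ∈ T → a ∈ T) (hTsup : ∀ a b, a ∈ T → b ∈ T → a ⊔ b ∈ T)
    (hST : ∀ a ∈ S, a ∉ T) :
    ∃ F : DualSpace A, (∀ a ∈ S, a ∈ F.1) ∧ ∀ a ∈ T, a ∉ F.1 := by
  have hI : Order.IsIdeal T := ⟨fun a b hba ha => hTle b a hba ha, hT, fun a ha b hb =>
    ⟨a ⊔ b, hTsup a b ha hb, le_sup_left, le_sup_right⟩⟩
  have hF : Order.IsPFilter S := Order.IsPFilter.of_def hS
    (fun a ha b hb => ⟨a ⊓ b, hSinf a b ha hb, inf_le_left, inf_le_right⟩)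
    (fun {a b} h ha => hSle a b h ha)
  obtain ⟨J, hJ, hTJ, hSJ⟩ := DistribLattice.prime_ideal_of_disjoint_filter_ideal
    (F := hF.toPFilter) (I := hI.toIdeal) (Set.disjoint_left.2 hST)
  refine ⟨⟨hJ.toPrimePair.F, hJ.toPrimePair.F_isPrime⟩, fun a ha => ?_, fun a ha h => ?_⟩
  · exact Set.disjoint_left.1 hSJ ha
  · exact h (hTJ ha)

theorem exists_mem_notMem {a b : A} (h : ¬ a ≤ b) : ∃ F : DualSpace A, a ∈ F.1 ∧ b ∉ F.1 := by
  obtain ⟨F, h1, h2⟩ := exists_of_disjoint (Set.Ici a) (Set.Iic b) ⟨a, le_rfl⟩ ⟨b, le_rfl⟩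
    (fun x y hxy hx => le_trans hx hxy) (fun x y hx hy => le_inf hx hy)
    (fun x y hxy hy => le_trans hxy hy) (fun x y hx hy => sup_le hx hy)
    (fun x hx hx' => h (le_trans hx hx'))
  exact ⟨F, h1 a le_rfl, h2 b le_rfl⟩

/-- For the converse, the elements `c` with `a ⇨ c ∈ F` form the filter generated by `F` and `a`. It
omits `b` when `a ⇨ b ∉ F`, so it extends to a prime filter omitting `b`. -/
theorem himp_mem_iff (F : DualSpace A) {a b : A} :
    a ⇨ b ∈ F.1 ↔ ∀ G : DualSpace A, F ≤ G → a ∈ G.1 → b ∈ G.1 := by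
  refine ⟨fun h G hFG ha => ?_, fun h => ?_⟩
  · exact Order.PFilter.mem_of_le himp_inf_le (G.inf_mem_iff.2 ⟨hFG h, ha⟩)
  · by_contra hab
    obtain ⟨G, h1, h2⟩ := exists_of_disjoint {c | a ⇨ c ∈ F.1} (Set.Iic b)
      ⟨⊤, by simp⟩ ⟨b, le_rfl⟩
      (fun x y hxy hx => Order.PFilter.mem_of_le (himp_le_himp_left hxy) hx)
      (fun x y hx hy => by
        simp only [Set.mem_ofPred_eq, himp_inf_distrib]
        exact F.inf_mem_iff.2 ⟨hx, hy⟩)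
      (fun x y hxy hy => le_trans hxy hy) (fun x y hx hy => sup_le hx hy)
      (fun x hx hx' => hab (Order.PFilter.mem_of_le (himp_le_himp_left hx') hx))
    refine h2 b le_rfl (h G (fun c hc => h1 c (Order.PFilter.mem_of_le le_himp hc)) (h1 a ?_))
    simp

theorem finset_sup_mem_iff {ι : Type*} (F : DualSpace A) (s : Finset ι) (f : ι → A) :
    s.sup f ∈ F.1 ↔ ∃ i ∈ s, f i ∈ F.1 := by
  classical
  induction s using Finset.induction_on with
  | empty => simpa using F.bot_notMem
  | insert i s _ ih => simp [Finset.sup_insert, sup_mem_iff, ih]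

theorem finset_inf_mem_iff {ι : Type*} (F : DualSpace A) (s : Finset ι) (f : ι → A) :
    s.inf f ∈ F.1 ↔ ∀ i ∈ s, f i ∈ F.1 := by
  classical
  induction s using Finset.induction_on with
  | empty => simp
  | insert i s _ ih => simp [Finset.inf_insert, ih]

theorem isClopen_mem (a : A) : IsClopen {F : DualSpace A | a ∈ F.1} :=
  ⟨⟨TopologicalSpace.isOpen_generateFrom_of_mem (Or.inr ⟨a, rfl⟩)⟩,
    TopologicalSpace.isOpen_generateFrom_of_mem (Or.inl ⟨a, rfl⟩)⟩

/-- In a compact dual space, every clopen upset consists of the prime filters containing some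
fixed element. -/
theorem exists_mem_iff_of_isClopen [CompactSpace (DualSpace A)] {U : Set (DualSpace A)}
    (hU : IsClopen U) (hup : IsUpperSet U) : ∃ a : A, ∀ F : DualSpace A, a ∈ F.1 ↔ F ∈ U := by
  classical
  -- Compactness is used twice: on `U`, to get a finite join that separates `U` from one point
  -- outside, and on the complement, to get a finite meet of such joins.
  have step : ∀ G ∉ U, ∃ a : A, a ∉ G.1 ∧ ∀ F ∈ U, a ∈ F.1 := by
    intro G hG
    have hsep : ∀ F : U, ∃ a : A, a ∈ F.1.1 ∧ a ∉ G.1 := by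
      intro F
      by_contra! h
      exact hG (hup (show F.1 ≤ G from h) F.2)
    choose c hcF hcG using hsep
    obtain ⟨t, ht⟩ := hU.isClosed.isCompact.elim_finite_subcover
      (fun F : U => {H : DualSpace A | c F ∈ H.1}) (fun F => (isClopen_mem _).isOpen)
      (fun F hF => Set.mem_iUnion.2 ⟨⟨F, hF⟩, hcF ⟨F, hF⟩⟩)
    refine ⟨t.sup c, fun h => ?_, fun F hF => ?_⟩
    · obtain ⟨F, -, h⟩ := (G.finset_sup_mem_iff t c).1 h
      exact hcG F h
    · obtain ⟨H, hH, h⟩ := Set.mem_iUnion₂.1 (ht hF)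
      exact (F.finset_sup_mem_iff t c).2 ⟨H, hH, h⟩
  choose! c hcG hcU using step
  obtain ⟨t, ht⟩ := hU.compl.isClosed.isCompact.elim_finite_subcover
    (fun G : (Uᶜ : Set (DualSpace A)) => {H : DualSpace A | c G ∈ H.1}ᶜ)
    (fun G => (isClopen_mem _).compl.isOpen)
    (fun G hG => Set.mem_iUnion.2 ⟨⟨G, hG⟩, hcG G hG⟩)
  refine ⟨t.inf fun G => c G, fun F => ⟨fun h => ?_, fun hF => ?_⟩⟩
  · by_contra hF
    obtain ⟨H, hH, h'⟩ := Set.mem_iUnion₂.1 (ht hF)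
    exact h' ((F.finset_inf_mem_iff t _).1 h H hH)
  · exact (F.finset_inf_mem_iff t _).2 fun G _ => hcU G G.2 F hF

end Basic

/-! ### Duals of homomorphisms. -/

section Comap

variable {A : Type u} {C : Type v} [HeytingAlgebra A] [HeytingAlgebra C]

/-- The map of dual spaces induced by a homomorphism. -/
def comap (g : HeytingHom A C) (P : DualSpace C) : DualSpace A :=
  ofSet {a | g a ∈ P.1} (by simp) (by simpa using P.bot_notMem)
    (fun _ _ hab ha => Order.PFilter.mem_of_le (OrderHomClass.mono g hab) ha)
    (fun a b ha hb => by
      simp only [Set.mem_ofPred_eq, map_inf]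
      exact P.inf_mem_iff.2 ⟨ha, hb⟩)
    (fun a b h => by
      simp only [Set.mem_ofPred_eq, map_sup] at h
      exact P.sup_mem_iff.1 h)

@[simp]
theorem mem_comap {g : HeytingHom A C} {P : DualSpace C} {a : A} :
    a ∈ (comap g P).1 ↔ g a ∈ P.1 := Iff.rfl

theorem comap_mono (g : HeytingHom A C) : Monotone (comap g) := fun _ _ h _ ha => h ha

/-- This is the back condition for the dual map. `P'` must contain `P` and the image of `Q` while
avoiding the image of the complement of `Q`. If `p ⊓ g q ≤ g r`, then `p ≤ g (q ⇨ r)`, so `q ⇨ r ∈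
Q`, and `q ∈ Q` forces `r ∈ Q`; thus the filter and the ideal are disjoint. -/
theorem exists_comap_eq (g : HeytingHom A C) {P : DualSpace C} {Q : DualSpace A}
    (h : comap g P ≤ Q) : ∃ P', P ≤ P' ∧ comap g P' = Q := by
  obtain ⟨P', h1, h2⟩ := exists_of_disjoint {c | ∃ p ∈ P.1, ∃ q ∈ Q.1, p ⊓ g q ≤ c}
    {c | ∃ r, r ∉ Q.1 ∧ c ≤ g r} ⟨⊤, ⊤, by simp, ⊤, by simp, le_top⟩
    ⟨⊥, ⊥, Q.bot_notMem, bot_le⟩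
    (fun a b hab ⟨p, hp, q, hq, h⟩ => ⟨p, hp, q, hq, h.trans hab⟩)
    (fun a b ⟨p, hp, q, hq, h⟩ ⟨p', hp', q', hq', h'⟩ =>
      ⟨p ⊓ p', P.inf_mem_iff.2 ⟨hp, hp'⟩, q ⊓ q', Q.inf_mem_iff.2 ⟨hq, hq'⟩, by
        rw [map_inf, inf_inf_inf_comm]
        exact inf_le_inf h h'⟩)
    (fun a b hab ⟨r, hr, h⟩ => ⟨r, hr, hab.trans h⟩)
    (fun a b ⟨r, hr, h⟩ ⟨r', hr', h'⟩ =>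
      ⟨r ⊔ r', fun hm => (Q.sup_mem_iff.1 hm).elim hr hr', by
        rw [map_sup]
        exact sup_le_sup h h'⟩)
    (by
      rintro a ⟨p, hp, q, hq, hle⟩ ⟨r, hr, har⟩
      refine hr ?_
      have hqr : q ⇨ r ∈ Q.1 := by
        refine le_iff.1 h (q ⇨ r) ?_
        rw [mem_comap, map_himp]
        exact Order.PFilter.mem_of_le (le_himp_iff.2 (hle.trans har)) hp
      exact Order.PFilter.mem_of_le himp_inf_le (Q.inf_mem_iff.2 ⟨hqr, hq⟩))
  refine ⟨P', fun p hp => h1 p ⟨p, hp, ⊤, by simp, inf_le_left⟩, eq_of_mem_iff fun a => ?_⟩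
  refine ⟨fun ha => ?_, fun ha => h1 _ ⟨⊤, by simp, a, ha, inf_le_right⟩⟩
  by_contra haQ
  exact h2 _ ⟨a, haQ, le_rfl⟩ ha

end Comap

/-! ### The double dual of an Esakia space. -/

section Points

variable {X : Type u} [TopologicalSpace X] [PartialOrder X] [EsakiaSpace X]

/-- The prime filter of the clopen upsets containing a given point. -/
def ofPoint (x : X) : DualSpace (ClopenUpperSet X) :=
  ofSet {U | x ∈ U} trivial (fun h => h) (fun _ _ h hx => h hx)
    (fun _ _ h h' => ⟨h, h'⟩) (fun _ _ h => h)

/-- A clopen neighbourhood of `y` that misses the closed set `↑x` has a clopen downset; its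
complement is the required upset. -/
theorem _root_.HeytES.EsakiaSpace.exists_clopenUpperSet {x y : X} (h : ¬ x ≤ y) :
    ∃ U : ClopenUpperSet X, x ∈ U ∧ y ∉ U := by
  obtain ⟨V, hV, hyV, hVx⟩ := (EsakiaSpace.basis_clopen (X := X)).exists_subset_of_mem_open
    (a := y) (u := (Set.Ici x)ᶜ) h (EsakiaSpace.isClosed_upset x).isOpen_compl
  refine ⟨⟨⟨{z | ∃ w ∈ V, z ≤ w}ᶜ, (EsakiaSpace.isClopen_downset V hV).compl⟩,
    fun z z' hz h' ⟨w, hw, hle⟩ => h' ⟨w, hw, hz.trans hle⟩⟩, ?_, ?_⟩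
  · rintro ⟨w, hw, hxw⟩
    exact hVx hw hxw
  · exact fun h' => h' ⟨y, hyV, le_rfl⟩

theorem ofPoint_le_iff {x y : X} : ofPoint x ≤ ofPoint y ↔ x ≤ y := by
  refine ⟨fun h => ?_, fun h U hU => U.upper h hU⟩
  by_contra hxy
  obtain ⟨U, hx, hy⟩ := EsakiaSpace.exists_clopenUpperSet hxy
  exact hy (le_iff.1 h U hx)

theorem ofPoint_surjective : Function.Surjective (ofPoint (X := X)) := by
  classical
  intro F
  by_contra! hF
  -- The choices `U = ⊤` and `V = ⊥` cover the two ways in which `F` can differ from the filter of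
  -- `x`. Finitely many such pairs then give a meet in `F` below a join outside `F`.
  have hsep : ∀ x : X, ∃ U V : ClopenUpperSet X, U ∈ F.1 ∧ V ∉ F.1 ∧ (x ∈ U → x ∈ V) := by
    intro x
    by_contra! h
    refine hF x (eq_of_mem_iff fun U => ⟨fun hU => ?_, fun hU => ?_⟩)
    · by_contra hUF
      exact (h ⊤ U (by simp) hUF).2 hU
    · exact (h U ⊥ hU F.bot_notMem).1
  choose U V hU hV hUV using hsep
  obtain ⟨t, ht⟩ := isCompact_univ.elim_finite_subcover
    (fun x : X => ((U x : Set X)ᶜ ∪ V x)) (fun x => ((U x).isClopen.compl.union (V x).isClopen).2)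
    (fun x _ => Set.mem_iUnion.2 ⟨x, by
      by_cases hx : x ∈ U x
      · exact Or.inr (hUV x hx)
      · exact Or.inl hx⟩)
  have h1 : t.inf U ∈ F.1 := (F.finset_inf_mem_iff t U).2 fun x _ => hU x
  have h2 : t.sup V ∉ F.1 := fun h =>
    let ⟨x, _, hx⟩ := (F.finset_sup_mem_iff t V).1 h
    hV x hx
  refine h2 (Order.PFilter.mem_of_le (fun y hy => ?_) h1)
  obtain ⟨x, hx, hy'⟩ := Set.mem_iUnion₂.1 (ht (Set.mem_univ y))
  rcases hy' with hy' | hy'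
  · exact absurd (((ofPoint y).finset_inf_mem_iff t U).1 hy x hx) hy'
  · exact ((ofPoint y).finset_sup_mem_iff t V).2 ⟨x, hx, hy'⟩

/-- An Esakia space is order isomorphic to its double dual. -/
noncomputable def pointIso : X ≃o DualSpace (ClopenUpperSet X) :=
  RelIso.ofSurjective (OrderEmbedding.ofMapLEIff (ofPoint (X := X)) fun _ _ => ofPoint_le_iff)
    ofPoint_surjective

end Points

end DualSpace

end HeytES

/-! ### Width as an equational condition. -/

namespace HeytES

namespace HeytingTerm

/-- The join of a finite list of terms. -/
def join {V : Type v} : List (HeytingTerm V) → HeytingTerm V :=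
  List.foldr sup bot

/-- The term `⋁ i ≤ n, (x i → ⋁ j ≤ n, j ≠ i, x j)`. -/
def width (n : ℕ) : HeytingTerm ℕ :=
  join ((List.range (n + 1)).map fun i =>
    imp (var i) (join (((List.range (n + 1)).filter (· ≠ i)).map var)))

variable {A : Type u} [HeytingAlgebra A]

theorem eval_join_mem_iff {V : Type v} (F : DualSpace A) (e : V → A) (l : List (HeytingTerm V)) :
    (join l).eval e ∈ F.1 ↔ ∃ t ∈ l, t.eval e ∈ F.1 := by
  induction l with
  | nil => simpa [join, eval] using F.bot_notMem
  | cons t l ih =>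
    rw [List.exists_mem_cons_iff, ← ih]
    exact F.sup_mem_iff

theorem eval_width_mem_iff (n : ℕ) (F : DualSpace A) (e : ℕ → A) :
    (width n).eval e ∈ F.1 ↔ ∃ i ≤ n, ∀ G : DualSpace A, F ≤ G → e i ∈ G.1 →
      ∃ j ≤ n, j ≠ i ∧ e j ∈ G.1 := by
  simp [width, eval_join_mem_iff, eval, DualSpace.himp_mem_iff, and_assoc]

end HeytingTerm

theorem widthAtMost_iff_forall_fin {n : ℕ} {X : Type u} [PartialOrder X] :
    WidthAtMost n X ↔ ∀ (x : X) (y : Fin (n + 1) → X), (∀ i, x ≤ y i) →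
      ∃ i j, i ≠ j ∧ y i ≤ y j := by
  classical
  constructor
  · intro h x y hxy
    by_contra! hy
    refine h x ⟨Finset.univ.image y, ?_, by simpa using hxy, ?_⟩
    · rw [Finset.card_image_of_injective, Finset.card_univ, Fintype.card_fin]
      intro i j hij
      by_contra hne
      exact hy i j hne hij.le
    · simp only [Finset.coe_image, Finset.coe_univ, Set.image_univ]
      rintro _ ⟨i, rfl⟩ _ ⟨j, rfl⟩ hne
      exact hy i j fun h => hne (h ▸ rfl)
  · rintro h x ⟨S, hS, hxS, hanti⟩
    obtain ⟨i, j, hij, hle⟩ := h x (fun i => (S.equivFinOfCardEq hS).symm i)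
      (fun i => hxS _ (Subtype.coe_prop _))
    refine hanti (Subtype.coe_prop _) (Subtype.coe_prop _) ?_ hle
    simpa [Subtype.coe_inj] using hij

/-- The term fails at a prime filter `F` exactly when, for each `i ≤ n`, some prime filter above `F`
contains the value of `x i` and of no other `x j`. Such filters are pairwise incomparable, and
conversely an antichain above `F` supplies such values. -/
theorem satisfies_width_iff (n : ℕ) (A : Type u) [HeytingAlgebra A] :
    Satisfies A (HeytingTerm.width n, .top) ↔ WidthAtMost n (DualSpace A) := by
  rw [widthAtMost_iff_forall_fin]
  constructor
  · intro h F y hFy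
    by_contra! hy
    have hsep : ∀ i j, ∃ a : A, a ∈ (y i).1 ∧ (i ≠ j → a ∉ (y j).1) := by
      intro i j
      by_cases hij : i = j
      · exact ⟨⊤, by simp, fun h => absurd hij h⟩
      · by_contra! hle
        exact hy i j hij (fun a ha => (hle a ha).2)
    choose c hc hc' using hsep
    -- The meet of the `c i j` over `j` lies in `y i` and in no other `y j`. Variables beyond `n` do
    -- not occur in the term, so their value `⊥` is harmless.
    have key := (HeytingTerm.eval_width_mem_iff n F
      (fun i => if hi : i < n + 1 then Finset.univ.inf (c ⟨i, hi⟩) else ⊥)).1 (by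
        rw [h]
        exact Order.PFilter.top_mem)
    obtain ⟨i, hi, hG⟩ := key
    have hi' : i < n + 1 := Nat.lt_succ_of_le hi
    obtain ⟨j, hj, hji, hmem⟩ := hG (y ⟨i, hi'⟩) (hFy _) (by
      rw [dif_pos hi', DualSpace.finset_inf_mem_iff]
      exact fun k _ => hc _ _)
    rw [dif_pos (Nat.lt_succ_of_le hj), DualSpace.finset_inf_mem_iff] at hmem
    exact hc' _ _ (fun h => hji (Fin.ext_iff.1 h)) (hmem ⟨i, hi'⟩ (Finset.mem_univ _))
  · intro h e
    refine top_le_iff.1 ?_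
    by_contra hle
    obtain ⟨F, -, hF⟩ := DualSpace.exists_mem_notMem hle
    rw [HeytingTerm.eval_width_mem_iff] at hF
    push Not at hF
    choose y hFy hey hy using hF
    obtain ⟨i, j, hij, hle⟩ := h F (fun i : Fin (n + 1) => y i (Nat.le_of_lt_succ i.2))
      (fun i => hFy i (Nat.le_of_lt_succ i.2))
    exact hy j _ i (Nat.le_of_lt_succ i.2) (fun h => hij (Fin.ext h)) (hle (hey i _))

theorem isVariety_W (n : ℕ) : IsVariety (W.{u} n) :=
  ⟨{(HeytingTerm.width n, .top)}, fun A =>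
    ⟨fun h _ hp => hp ▸ (satisfies_width_iff n A).2 h,
      fun h => (satisfies_width_iff n A).1 (h _ rfl)⟩⟩

/-- Varieties are closed under subalgebras. -/
theorem IsVariety.of_injective {K : ObjectProperty HeytAlg.{u}} (hK : IsVariety K)
    {A B : HeytAlg.{u}} (hA : K A) (f : HeytingHom B A) (hf : Function.Injective f) : K B := by
  obtain ⟨E, hE⟩ := hK
  have heval : ∀ (e : ℕ → B) (t : HeytingTerm ℕ), f (t.eval e) = t.eval (f ∘ e) := by
    intro e t
    induction t <;> simp_all [HeytingTerm.eval]
  refine (hE B).2 fun p hp e => hf ?_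
  rw [heval, heval]
  exact (hE A).1 hA p hp _

/-! ### The width of `X_n^∞`. -/

theorem widthAtMost_of_comparable {n : ℕ} {X : Type u} [PartialOrder X] (c : X → Fin n)
    (hc : ∀ x y, c x = c y → x ≤ y ∨ y ≤ x) : WidthAtMost n X := by
  rw [widthAtMost_iff_forall_fin]
  intro x y _
  obtain ⟨i, j, hij, h⟩ := Fintype.exists_ne_map_eq_of_card_lt (c ∘ y) (by simp)
  rcases hc _ _ h with h | h
  exacts [⟨i, j, hij, h⟩, ⟨j, i, hij.symm, h⟩]

theorem WidthAtMost.of_orderEmbedding {n : ℕ} {X : Type u} {Y : Type v} [PartialOrder X]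
    [PartialOrder Y] (h : WidthAtMost n Y) (f : X ↪o Y) : WidthAtMost n X := by
  rw [widthAtMost_iff_forall_fin] at h ⊢
  intro x y hxy
  obtain ⟨i, j, hij, hle⟩ := h (f x) (f ∘ y) (fun i => f.le_iff_le.2 (hxy i))
  exact ⟨i, j, hij, f.le_iff_le.1 hle⟩

/-- The sum `X_n^∞` is a union of `n` chains. -/
theorem XnInf.widthAtMost {n : ℕ} (hn : 1 < n) : WidthAtMost n (XnInf.{u} n) := by
  let z : Fin n := ⟨0, by omega⟩
  let o : Fin n := ⟨1, hn⟩
  -- The colours cut each copy into the chains `{a_1, b_2}`, `{a_2, b_1}` and `{a_i, b_i}` for `i >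
  -- 2`. Points in different copies are always comparable.
  let d : Xn.{u} n → Fin n := fun x => match x with
    | .a i => i
    | .b i => Equiv.swap z o i
  have hab : ∀ i j : Fin n, i = Equiv.swap z o j → (Xn.a i : Xn.{u} n) ≤ Xn.b j := by
    rintro i j rfl
    by_cases hz : j = z
    · subst hz
      rw [Equiv.swap_apply_left]
      exact Xn.Le.later _ _ one_ne_zero (Or.inl rfl)
    by_cases ho : j = o
    · subst ho
      rw [Equiv.swap_apply_right]
      exact Xn.Le.first _ _ rfl one_ne_zero
    · rw [Equiv.swap_apply_of_ne_of_ne hz ho]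
      exact Xn.Le.later _ _ (fun h => hz (Fin.ext h)) (Or.inr rfl)
  have hd : ∀ x y : Xn.{u} n, d x = d y → x ≤ y ∨ y ≤ x := by
    rintro (i | i) (j | j) h
    · obtain rfl : i = j := h
      exact Or.inl le_rfl
    · exact Or.inl (hab i j h)
    · exact Or.inr (hab j i h.symm)
    · obtain rfl : i = j := (Equiv.swap z o).injective h
      exact Or.inl le_rfl
  refine widthAtMost_of_comparable (fun p => match p with
    | .pt _ x => d x
    | .top => z) ?_
  rintro (⟨k, x⟩ | _) (⟨m, y⟩ | _) h
  · rcases lt_trichotomy k m with hkm | rfl | hkm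
    · exact Or.inl (InfSum.Le.lt _ _ _ _ hkm)
    · exact (hd x y h).imp (InfSum.Le.same _ _ _) (InfSum.Le.same _ _ _)
    · exact Or.inr (InfSum.Le.lt _ _ _ _ hkm)
  · exact Or.inl (InfSum.Le.le_top _)
  · exact Or.inr (InfSum.Le.le_top _)
  · exact Or.inl le_rfl

theorem varietyGeneratedBy_le_W {n : ℕ} (hn : 1 < n) :
    varietyGeneratedBy (dualAlgebra (XnInf.{u} n)) ≤ W.{u} n := fun _ hB =>
  hB _ (isVariety_W n)
    ((XnInf.widthAtMost hn).of_orderEmbedding DualSpace.pointIso.symm.toOrderEmbedding)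

end HeytES

namespace HeytES

/-! ### The order of `X_n^∞` and its gluing. -/

namespace Xn

variable {n : ℕ}

@[simp]
theorem a_le_a {i j : Fin n} : (a i : Xn.{u} n) ≤ a j ↔ i = j :=
  ⟨fun h => by cases h; rfl, fun h => h ▸ le_rfl⟩

@[simp]
theorem b_le_b {i j : Fin n} : (b i : Xn.{u} n) ≤ b j ↔ i = j :=
  ⟨fun h => by cases h; rfl, fun h => h ▸ le_rfl⟩

@[simp]
theorem not_b_le_a {i j : Fin n} : ¬ (b i : Xn.{u} n) ≤ a j := fun h => by cases h

@[simp]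
theorem a_le_b {i j : Fin n} : (a i : Xn.{u} n) ≤ b j ↔
    (i.val = 0 ∧ j.val ≠ 0) ∨ (i.val ≠ 0 ∧ (j.val = 0 ∨ j = i)) := by
  constructor
  · intro h
    cases h with
    | first _ _ hi hj => exact Or.inl ⟨hi, hj⟩
    | later _ _ hi hj => exact Or.inr ⟨hi, hj⟩
  · rintro (⟨hi, hj⟩ | ⟨hi, hj⟩)
    exacts [Le.first _ _ hi hj, Le.later _ _ hi hj]

end Xn

namespace XnInf

variable {n : ℕ}

open InfSum

@[simp]
theorem pt_le_pt {k m : ℕ} {x y : Xn.{u} n} :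
    (pt k x : XnInf.{u} n) ≤ pt m y ↔ k < m ∨ k = m ∧ x ≤ y := by
  constructor
  · intro h
    cases h with
    | same _ _ _ h => exact Or.inr ⟨rfl, h⟩
    | lt _ _ _ _ h => exact Or.inl h
  · rintro (h | ⟨rfl, h⟩)
    exacts [Le.lt _ _ _ _ h, Le.same _ _ _ h]

@[simp]
theorem le_top' (p : XnInf.{u} n) : p ≤ top := Le.le_top p

@[simp]
theorem not_top_le_pt {m : ℕ} {y : Xn.{u} n} : ¬ (top : XnInf.{u} n) ≤ pt m y :=
  fun h => by cases h

/-- The pairs of points that have to be glued in order to obtain an epic subalgebra: `b_1` is glued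
to the copy of `a_1` in the next summand, and `a_m` to `b_m` for `m > 1`. -/
inductive Glued : XnInf.{u} n → XnInf.{u} n → Prop
  | shift (k : ℕ) (i : Fin n) (hi : i.val = 0) : Glued (pt k (.b i)) (pt (k + 1) (.a i))
  | level (k : ℕ) (i : Fin n) (hi : i.val ≠ 0) : Glued (pt k (.a i)) (pt k (.b i))

/-- The reflexive and symmetric closure of `Glued`. -/
def Related (x y : XnInf.{u} n) : Prop := x = y ∨ Glued x y ∨ Glued y x

theorem Related.symm {x y : XnInf.{u} n} (h : Related x y) : Related y x := by
  rcases h with h | h | h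
  exacts [Or.inl h.symm, Or.inr (Or.inr h), Or.inr (Or.inl h)]

theorem Glued.le {x y : XnInf.{u} n} (h : Glued x y) : x ≤ y := by
  cases h with
  | shift k i hi => simp
  | level k i hi => simp [hi]

/-- This makes saturated sets closed under implication. Above `b_1` of copy `k` but not above `a_1`
of copy `k + 1` there are, besides `b_1` itself, only the `a_m` with `m > 1` and `b_1` of copy `k +
1`; these are glued to `b_m` and to the next `a_1`. Above `a_m` but not above `b_m` there are only
`a_m` and `b_1` of the same copy, the latter glued to the next `a_1`. -/
theorem Glued.exists_related {x y z : XnInf.{u} n} (h : Glued x y) (hxz : x ≤ z) :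
    ∃ w, y ≤ w ∧ Related z w := by
  cases h with
  | shift k i hi =>
    rcases z with ⟨m, c | c⟩ | _
    · have hkm : k < m := by simpa using hxz
      by_cases hc : c.val = 0
      · have hic : i = c := Fin.ext (hi.trans hc.symm)
        exact ⟨_, by simp [hic]; omega, Or.inl rfl⟩
      · exact ⟨pt m (.b c), by simp [hi, hc]; omega, Or.inr (Or.inl (.level _ _ hc))⟩
    · rw [pt_le_pt, Xn.b_le_b] at hxz
      by_cases hc : c.val = 0
      · have hic : i = c := Fin.ext (hi.trans hc.symm)
        exact ⟨pt (m + 1) (.a c), by simp [hic]; omega, Or.inr (Or.inl (.shift _ _ hc))⟩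
      · refine ⟨pt m (.b c), ?_, Or.inl rfl⟩
        rcases hxz with h | ⟨_, rfl⟩
        · simp [hi, hc]; omega
        · exact absurd hi hc
    · exact ⟨top, by simp, Or.inl rfl⟩
  | level k i hi =>
    rcases z with ⟨m, c | c⟩ | _
    · rw [pt_le_pt, Xn.a_le_a] at hxz
      rcases hxz with h | ⟨rfl, rfl⟩
      · exact ⟨_, by simp [h], Or.inl rfl⟩
      · exact ⟨_, le_rfl, Or.inr (Or.inl (.level _ _ hi))⟩
    · rw [pt_le_pt, Xn.a_le_b] at hxz
      rcases hxz with h | ⟨rfl, ⟨h, _⟩ | ⟨_, h | rfl⟩⟩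
      · exact ⟨_, by simp [h], Or.inl rfl⟩
      · exact absurd h hi
      · exact ⟨pt (k + 1) (.a c), by simp, Or.inr (Or.inl (.shift _ _ h))⟩
      · exact ⟨_, le_rfl, Or.inl rfl⟩
    · exact ⟨top, by simp, Or.inl rfl⟩

/-- A set is saturated if it respects the gluing. -/
def Saturated (U : Set (XnInf.{u} n)) : Prop := ∀ ⦃x y⦄, Glued x y → (x ∈ U ↔ y ∈ U)

/-! ### Saturated clopen upsets and separation of points. -/

theorem isClopen_of_tail {U : Set (XnInf.{u} n)} (htop : top ∈ U) (k : ℕ)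
    (hk : ∀ m, k ≤ m → ∀ x, pt m x ∈ U) : IsClopen U :=
  ⟨⟨isOpen_def.2 ⟨fun _ => isOpen_discrete _, fun h => absurd htop h⟩⟩,
    isOpen_def.2 ⟨fun _ => isOpen_discrete _, fun _ => ⟨k, hk⟩⟩⟩

/-- The clopen upset consisting of the `k`-th copy of `b_1` and all later summands. -/
def upB (k : ℕ) : ClopenUpperSet (XnInf.{u} n) where
  carrier := {p | match p with
    | pt m (.a _) => k < m
    | pt m (.b i) => k < m ∨ m = k ∧ i.val = 0
    | top => True}
  isClopen' := isClopen_of_tail trivial (k + 1) (by rintro m hm (x | x) <;> simp <;> omega)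
  upper' := by
    rintro (⟨m, i | i⟩ | _) (⟨l, j | j⟩ | _) hle h <;> simp [Fin.ext_iff] at hle h ⊢ <;> omega

/-- The clopen upset consisting of the `k`-th copies of `a_i`, `b_i` and `b_1`, and of all later
summands. -/
def upAB (k : ℕ) (c : Fin n) (hc : c.val ≠ 0) : ClopenUpperSet (XnInf.{u} n) where
  carrier := {p | match p with
    | pt m (.a i) => k < m ∨ m = k ∧ i = c
    | pt m (.b i) => k < m ∨ m = k ∧ (i.val = 0 ∨ i = c)
    | top => True}
  isClopen' := isClopen_of_tail trivial (k + 1) (by rintro m hm (x | x) <;> simp <;> omega)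
  upper' := by
    rintro (⟨m, i | i⟩ | _) (⟨l, j | j⟩ | _) hle h <;> simp [Fin.ext_iff] at hle h ⊢ <;> omega

section Mem

variable {k m : ℕ} {i c : Fin n} {hc : c.val ≠ 0}

@[simp] theorem top_mem_upB : (top : XnInf.{u} n) ∈ upB k := trivial

@[simp] theorem a_mem_upB : (pt m (.a i) : XnInf.{u} n) ∈ upB k ↔ k < m := Iff.rfl

@[simp] theorem b_mem_upB : (pt m (.b i) : XnInf.{u} n) ∈ upB k ↔ k < m ∨ m = k ∧ i.val = 0 :=
  Iff.rfl

@[simp] theorem a_mem_upAB :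
    (pt m (.a i) : XnInf.{u} n) ∈ upAB k c hc ↔ k < m ∨ m = k ∧ i = c := Iff.rfl

@[simp] theorem b_mem_upAB :
    (pt m (.b i) : XnInf.{u} n) ∈ upAB k c hc ↔ k < m ∨ m = k ∧ (i.val = 0 ∨ i = c) := Iff.rfl

end Mem

theorem saturated_upB (k : ℕ) :
    Saturated ((upB k : ClopenUpperSet (XnInf.{u} n)) : Set (XnInf.{u} n)) := by
  rintro _ _ (⟨m, i, hi⟩ | ⟨m, i, hi⟩) <;> (simp [hi]; try omega)

theorem saturated_upAB (k : ℕ) (c : Fin n) (hc : c.val ≠ 0) :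
    Saturated ((upAB k c hc : ClopenUpperSet (XnInf.{u} n)) : Set (XnInf.{u} n)) := by
  rintro _ _ (⟨m, i, hi⟩ | ⟨m, i, hi⟩) <;> (simp [hi, Fin.ext_iff]; try omega)

/-- The saturated clopen upsets separate unrelated points. -/
theorem related_of_forall_saturated {x y : XnInf.{u} n}
    (h : ∀ U : ClopenUpperSet (XnInf.{u} n), Saturated (U : Set (XnInf.{u} n)) →
      (x ∈ U ↔ y ∈ U)) : Related x y := by
  have h1 := fun k => h _ (saturated_upB k)
  have h2 := fun k c hc => h _ (saturated_upAB k c hc)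
  clear h
  have htop : ∀ (k : ℕ) (x : Xn.{u} n),
      ¬ ∀ m, ((pt k x : XnInf.{u} n) ∈ upB m ↔ (top : XnInf.{u} n) ∈ upB m) := by
    rintro k (i | i) h <;> simpa using h (k + 1)
  have hle : ∀ (k l : ℕ) (x y : Xn.{u} n), k ≤ l →
      (∀ m, ((pt k x : XnInf.{u} n) ∈ upB m ↔ (pt l y : XnInf.{u} n) ∈ upB m)) →
      (∀ m c hc, ((pt k x : XnInf.{u} n) ∈ upAB m c hc ↔ (pt l y : XnInf.{u} n) ∈ upAB m c hc)) →
      Related (pt k x : XnInf.{u} n) (pt l y) := by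
    intro k l x y hkl h1 h2
    obtain rfl | rfl | hkl : l = k ∨ l = k + 1 ∨ k + 2 ≤ l := by omega
    · rcases x with i | i <;> rcases y with j | j
      · by_cases hij : i = j
        · exact Or.inl (by rw [hij])
        by_cases hi : i.val = 0
        · have := h2 l j (fun hj => hij (Fin.ext (hi.trans hj.symm)))
          simp [hij] at this
        · have := h2 l i hi
          simp [Ne.symm hij] at this
      · have h3 := h1 l
        simp only [a_mem_upB, b_mem_upB, lt_self_iff_false, false_or, true_and, false_iff] at h3
        have h4 := h2 l j h3
        simp only [a_mem_upAB, b_mem_upAB, lt_self_iff_false, false_or, true_and, or_true,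
          iff_true] at h4
        subst h4
        exact Or.inr (Or.inl (.level _ _ h3))
      · have h3 := h1 l
        simp only [a_mem_upB, b_mem_upB, lt_self_iff_false, false_or, true_and, iff_false] at h3
        have h4 := h2 l i h3
        simp only [a_mem_upAB, b_mem_upAB, lt_self_iff_false, false_or, true_and, or_true,
          true_iff] at h4
        subst h4
        exact Or.inr (Or.inr (.level _ _ h3))
      · by_cases hij : i = j
        · exact Or.inl (by rw [hij])
        have h3 := h1 l
        simp only [b_mem_upB, lt_self_iff_false, false_or, true_and] at h3
        by_cases hi : i.val = 0
        · exact absurd (Fin.ext (hi.trans (h3.1 hi).symm)) hij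
        · have := h2 l i hi
          simp [Ne.symm hij, mt h3.2 hi] at this
    -- In adjacent copies, `upB k` forces `x` to be `b_1`. Then `upB (k + 1)` and the sets `upAB (k
    -- + 1) j` leave only `a_1` for `y`.
    · have h3 := h1 k
      have h4 := h1 (k + 1)
      rcases x with i | i <;> rcases y with j | j <;> simp at h3 h4
      · by_cases hj : j.val = 0
        · obtain rfl : i = j := Fin.ext (h3.trans hj.symm)
          exact Or.inr (Or.inl (.shift _ _ h3))
        · have := h2 (k + 1) j hj
          simp at this
      · have := h2 (k + 1) j h4
        simp at this
    -- `upB (k + 1)` contains every copy from `k + 2` on and is disjoint from copy `k`.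
    · have h3 := h1 (k + 1)
      rcases x with i | i <;> rcases y with j | j <;> simp at h3 <;> omega
  rcases x with ⟨k, x⟩ | _ <;> rcases y with ⟨l, y⟩ | _
  · rcases le_total k l with hkl | hkl
    · exact hle k l x y hkl h1 h2
    · exact (hle l k y x hkl (fun m => (h1 m).symm) (fun m c hc => (h2 m c hc).symm)).symm
  · exact absurd h1 (htop k x)
  · exact absurd (fun m => (h1 m).symm) (htop l y)
  · exact Or.inl rfl

/-! ### Rigidity of bounded morphisms under bounded width. -/

/-- Two bounded morphisms from a poset of width at most `n` to `X_n^∞` with pointwise related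
values have no value pair `b_1`, `a_1` in consecutive summands. -/
theorem not_shift_of_width {Z : Type v} [PartialOrder Z] (hn : 1 < n) (hZ : WidthAtMost n Z)
    {G H : Z → XnInf.{u} n} (hG : Monotone G) (hH : Monotone H)
    (hG' : ∀ z y, G z ≤ y → ∃ w, z ≤ w ∧ G w = y) (hH' : ∀ z y, H z ≤ y → ∃ w, z ≤ w ∧ H w = y)
    (hGH : ∀ z, Related (G z) (H z)) {o : Fin n} (ho : o.val = 0) {k : ℕ} {z : Z}
    (hGz : G z = pt k (.b o)) (hHz : H z = pt (k + 1) (.a o)) : False := by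
  have hlevel : ∀ {k : ℕ} {z : Z}, G z = pt k (.b o) → H z = pt (k + 1) (.a o) →
      ∀ m : Fin n, ∃ w, z ≤ w ∧ G w = pt (k + 1) (.a m) ∧
        H w = pt (k + 1) (if m.val = 0 then .a m else .b m) := by
    intro k z hGz hHz m
    obtain ⟨w, hzw, hGw⟩ := hG' z (pt (k + 1) (.a m)) (by simp [hGz])
    refine ⟨w, hzw, hGw, ?_⟩
    have h1 := hGH w
    have h2 := hH hzw
    rw [hHz] at h2
    rw [hGw] at h1
    revert h1 h2
    generalize H w = q
    rintro (rfl | h1 | h1) h2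
    · rw [pt_le_pt, Xn.a_le_a] at h2
      obtain rfl : o = m := by simpa using h2
      simp [ho]
    · cases h1 with
      | level _ _ hm => simp [hm]
    · cases h1
      simp at h2
  -- Lifting `b_1` along `G` restores the discrepancy one copy higher, since `b_1` does not lie
  -- above `b_m` and its only other related point is the next `a_1`.
  have hshift : ∀ {k : ℕ} {w : Z} {m : Fin n}, m.val ≠ 0 → G w = pt k (.a m) →
      H w = pt k (.b m) → ∃ z, w ≤ z ∧ G z = pt k (.b o) ∧ H z = pt (k + 1) (.a o) := by
    intro k w m hm hGw hHw
    obtain ⟨z, hwz, hGz⟩ := hG' w (pt k (.b o)) (by simp [hGw, hm, ho])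
    refine ⟨z, hwz, hGz, ?_⟩
    have h1 := hGH z
    have h2 := hH hwz
    rw [hHw] at h2
    rw [hGz] at h1
    revert h1 h2
    generalize H z = q
    rintro (rfl | h1 | h1) h2
    · rw [pt_le_pt, Xn.b_le_b] at h2
      obtain rfl : m = o := by simpa using h2
      exact absurd ho hm
    · cases h1
      rfl
    · cases h1
      contradiction
  -- Copy `k + 1` does not suffice: `H z` is its `a_1`, which is not below its `b_1`. The antichain
  -- is therefore built in copy `k + 2`, reached through `a_2`, which exists as `n > 1`.
  obtain ⟨w₁, hzw₁, hGw₁, hHw₁⟩ := hlevel hGz hHz ⟨1, hn⟩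
  obtain ⟨z', hwz', hGz', hHz'⟩ := hshift one_ne_zero hGw₁ hHw₁
  choose w hw hGw hHw using hlevel hGz' hHz'
  obtain ⟨s, hzs, hHs⟩ := hH' z (pt (k + 1 + 1) (.b o)) (by simp [hHz])
  -- `G` sends the points `w m` to the distinct, pairwise incomparable `a_m`, while `H` sends `s` to
  -- `b_1` and the `w m` to `a_1` or `b_m`, all incomparable to `b_1`.
  obtain ⟨i, j, hij, hle⟩ := widthAtMost_iff_forall_fin.1 hZ z (Fin.cons s w) (by
    intro i
    cases i using Fin.cases with
    | zero => exact hzs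
    | succ m => exact hzw₁.trans (hwz'.trans (hw m)))
  cases i using Fin.cases with
  | zero =>
    cases j using Fin.cases with
    | zero => exact hij rfl
    | succ m =>
      have := hH hle
      simp only [Fin.cons_zero, Fin.cons_succ, hHs, hHw, pt_le_pt, lt_self_iff_false, true_and,
        false_or] at this
      split_ifs at this with hm
      · simp at this
      · rw [Xn.b_le_b] at this
        exact hm (this ▸ ho)
  | succ m =>
    cases j using Fin.cases with
    | zero =>
      have := hH hle
      simp only [Fin.cons_zero, Fin.cons_succ, hHs, hHw, pt_le_pt, lt_self_iff_false, true_and,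
        false_or] at this
      split_ifs at this with hm
      · simp [hm, ho] at this
      · rw [Xn.b_le_b] at this
        exact hm (this ▸ ho)
    | succ m' =>
      have := hG hle
      simp only [Fin.cons_succ, hGw, pt_le_pt, lt_self_iff_false, true_and, false_or,
        Xn.a_le_a] at this
      exact hij (congrArg Fin.succ this)

theorem not_glued_of_width {Z : Type v} [PartialOrder Z] (hn : 1 < n) (hZ : WidthAtMost n Z)
    {G H : Z → XnInf.{u} n} (hG : Monotone G) (hH : Monotone H)
    (hG' : ∀ z y, G z ≤ y → ∃ w, z ≤ w ∧ G w = y) (hH' : ∀ z y, H z ≤ y → ∃ w, z ≤ w ∧ H w = y)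
    (hGH : ∀ z, Related (G z) (H z)) (z : Z) : ¬ Glued (G z) (H z) := by
  intro h
  generalize hGz : G z = p at h
  generalize hHz : H z = q at h
  cases h with
  | shift k i hi => exact not_shift_of_width hn hZ hG hH hG' hH' hGH hi hGz hHz
  | level k i hi =>
    -- Moving up to a preimage of `b_1` under `G` reduces this case to the shift.
    obtain ⟨w, hzw, hGw⟩ := hG' z (pt k (.b ⟨0, by omega⟩)) (by simp [hGz, hi])
    have h1 := hGH w
    have h2 := hH hzw
    rw [hHz] at h2
    rw [hGw] at h1
    generalize hHw : H w = q at h1 h2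
    rcases h1 with rfl | h1 | h1
    · rw [pt_le_pt, Xn.b_le_b] at h2
      obtain rfl : i = ⟨0, by omega⟩ := by simpa using h2
      exact hi rfl
    · cases h1 with
      | shift _ _ h0 => exact not_shift_of_width hn hZ hG hH hG' hH' hGH h0 hGw hHw
    · cases h1
      contradiction

/-- Two bounded morphisms from a poset of width at most `n` to `X_n^∞` with pointwise related
values are equal. -/
theorem eq_of_related {Z : Type v} [PartialOrder Z] (hn : 1 < n) (hZ : WidthAtMost n Z)
    {G H : Z → XnInf.{u} n} (hG : Monotone G) (hH : Monotone H)
    (hG' : ∀ z y, G z ≤ y → ∃ w, z ≤ w ∧ G w = y) (hH' : ∀ z y, H z ≤ y → ∃ w, z ≤ w ∧ H w = y)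
    (hGH : ∀ z, Related (G z) (H z)) : G = H := by
  funext z
  rcases hGH z with h | h | h
  · exact h
  · exact absurd h (not_glued_of_width hn hZ hG hH hG' hH' hGH z)
  · exact absurd h (not_glued_of_width hn hZ hH hG hH' hG' (fun z => (hGH z).symm) z)

end XnInf

end HeytES

/-! ### The proper epic subalgebra. -/

namespace HeytES

/-- The Heyting algebra structure on a subset closed under the operations. -/
abbrev heytingAlgebraOfClosed {A : Type u} [HeytingAlgebra A] (S : Set A) (hbot : ⊥ ∈ S)
    (htop : ⊤ ∈ S) (hinf : ∀ a ∈ S, ∀ b ∈ S, a ⊓ b ∈ S) (hsup : ∀ a ∈ S, ∀ b ∈ S, a ⊔ b ∈ S)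
    (himp : ∀ a ∈ S, ∀ b ∈ S, a ⇨ b ∈ S) : HeytingAlgebra S :=
  letI : Max S := ⟨fun a b => ⟨a ⊔ b, hsup a a.2 b b.2⟩⟩
  letI : Min S := ⟨fun a b => ⟨a ⊓ b, hinf a a.2 b b.2⟩⟩
  letI : Top S := ⟨⟨⊤, htop⟩⟩
  letI : Bot S := ⟨⟨⊥, hbot⟩⟩
  letI : HImp S := ⟨fun a b => ⟨a ⇨ b, himp a a.2 b b.2⟩⟩
  letI : Compl S := ⟨fun a => ⟨(a : A)ᶜ, himp_bot (a : A) ▸ himp a a.2 ⊥ hbot⟩⟩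
  Function.Injective.heytingAlgebra (Subtype.val : S → A) Subtype.val_injective Iff.rfl Iff.rfl
    (fun _ _ => rfl) (fun _ _ => rfl) rfl rfl (fun _ => rfl) (fun _ _ => rfl)

theorem exists_subalgebra {A : Type u} [HeytingAlgebra A] (S : Set A) (hbot : ⊥ ∈ S)
    (htop : ⊤ ∈ S) (hinf : ∀ a ∈ S, ∀ b ∈ S, a ⊓ b ∈ S) (hsup : ∀ a ∈ S, ∀ b ∈ S, a ⊔ b ∈ S)
    (himp : ∀ a ∈ S, ∀ b ∈ S, a ⇨ b ∈ S) :
    ∃ (B : HeytAlg.{u}) (f : HeytingHom B A), Function.Injective f ∧ Set.range f = S := by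
  let _ := heytingAlgebraOfClosed S hbot htop hinf hsup himp
  exact ⟨HeytAlg.of S,
    { toFun := Subtype.val
      map_sup' := fun _ _ => rfl
      map_inf' := fun _ _ => rfl
      map_bot' := rfl
      map_himp' := fun _ _ => rfl }, Subtype.val_injective, Subtype.range_val⟩

namespace XnInf

variable {n : ℕ}

/-- The elements corresponding to saturated clopen upsets form a subalgebra. -/
theorem exists_saturated_subalgebra {A : Type u} [HeytingAlgebra A]
    (φ : XnInf.{u} n ≃o DualSpace A) :
    ∃ (B : HeytAlg.{u}) (f : HeytingHom B A), Function.Injective f ∧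
      Set.range f = {a | Saturated {y | a ∈ (φ y).1}} := by
  refine exists_subalgebra _ ?_ ?_ ?_ ?_ ?_
  · intro x y _
    simp [DualSpace.bot_notMem]
  · intro x y _
    simp
  · intro a ha b hb x y h
    have h1 := ha h
    have h2 := hb h
    simp only [Set.mem_ofPred_eq] at h1 h2 ⊢
    rw [DualSpace.inf_mem_iff, DualSpace.inf_mem_iff, h1, h2]
  · intro a ha b hb x y h
    have h1 := ha h
    have h2 := hb h
    simp only [Set.mem_ofPred_eq] at h1 h2 ⊢
    rw [DualSpace.sup_mem_iff, DualSpace.sup_mem_iff, h1, h2]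
  · intro a ha b hb x y h
    -- Glued points are comparable, so one direction is monotonicity; the other replaces a point
    -- above `x` by a related point above `y`.
    refine ⟨fun h' => DualSpace.le_iff.1 (φ.monotone h.le) _ h', fun h' => ?_⟩
    simp only [Set.mem_ofPred_eq] at h' ⊢
    rw [DualSpace.himp_mem_iff] at h' ⊢
    intro G hxG haG
    obtain ⟨z, rfl⟩ := φ.surjective G
    obtain ⟨w, hyw, hzw⟩ := h.exists_related (φ.le_iff_le.1 hxG)
    have key : ∀ c : A, Saturated {y | c ∈ (φ y).1} → (c ∈ (φ z).1 ↔ c ∈ (φ w).1) := by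
      intro c hc
      rcases hzw with rfl | h | h
      exacts [Iff.rfl, hc h, (hc h).symm]
    exact (key b hb).2 (h' _ (φ.monotone hyw) ((key a ha).1 haG))

/-- A homomorphism into an algebra of width at most `n` is determined by its values at the elements
corresponding to saturated clopen upsets. -/
theorem hom_eq_of_eqOn_saturated (hn : 1 < n) {A C : Type u} [HeytingAlgebra A]
    [HeytingAlgebra C] (hC : WidthAtMost n (DualSpace C)) (φ : XnInf.{u} n ≃o DualSpace A)
    (hφ : ∀ U : ClopenUpperSet (XnInf.{u} n), ∃ a : A, ∀ y, a ∈ (φ y).1 ↔ y ∈ U)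
    (g h : HeytingHom A C) (hgh : ∀ a, Saturated {y | a ∈ (φ y).1} → g a = h a) (a : A) :
    g a = h a := by
  have hmono : ∀ g : HeytingHom A C, Monotone fun P => φ.symm (DualSpace.comap g P) :=
    fun g => φ.symm.monotone.comp (DualSpace.comap_mono g)
  have hback : ∀ (g : HeytingHom A C) P y, φ.symm (DualSpace.comap g P) ≤ y →
      ∃ P', P ≤ P' ∧ φ.symm (DualSpace.comap g P') = y := by
    intro g P y hle
    obtain ⟨P', hP, h⟩ := DualSpace.exists_comap_eq g ((φ.symm_apply_le).1 hle)
    exact ⟨P', hP, by rw [h, φ.symm_apply_apply]⟩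
  have hrel : ∀ P, Related (φ.symm (DualSpace.comap g P)) (φ.symm (DualSpace.comap h P)) := by
    intro P
    refine related_of_forall_saturated fun U hU => ?_
    obtain ⟨a, ha⟩ := hφ U
    have hsat : Saturated {y | a ∈ (φ y).1} := fun x y h =>
      (ha x).trans ((hU h).trans (ha y).symm)
    rw [← ha, ← ha, φ.apply_symm_apply, φ.apply_symm_apply, DualSpace.mem_comap,
      DualSpace.mem_comap, hgh a hsat]
  have heq := eq_of_related hn hC (hmono g) (hmono h) (hback g) (hback h) hrel
  have hmem : ∀ P : DualSpace C, g a ∈ P.1 ↔ h a ∈ P.1 := by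
    intro P
    rw [← DualSpace.mem_comap, φ.symm.injective (congrFun heq P), DualSpace.mem_comap]
  refine le_antisymm ?_ ?_
  · by_contra hle
    obtain ⟨P, h1, h2⟩ := DualSpace.exists_mem_notMem hle
    exact h2 ((hmem P).1 h1)
  · by_contra hle
    obtain ⟨P, h1, h2⟩ := DualSpace.exists_mem_notMem hle
    exact h2 ((hmem P).2 h1)

theorem exists_not_saturated (hn : 1 < n) :
    ∃ U : ClopenUpperSet (XnInf.{u} n), ¬ Saturated (U : Set (XnInf.{u} n)) := by
  obtain ⟨U, hU, hU'⟩ := EsakiaSpace.exists_clopenUpperSet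
    (x := (.pt 0 (.b ⟨1, hn⟩) : XnInf.{u} n)) (y := .pt 0 (.a ⟨1, hn⟩)) (by simp)
  exact ⟨U, fun h => hU' ((h (Glued.level 0 ⟨1, hn⟩ one_ne_zero)).2 hU)⟩

/-- The topology of the dual enters only through `hφ`, so this one form serves both an abstract dual
isomorphic to `X_n^∞` and the concrete algebra of clopen upsets. -/
theorem not_hasES_of_orderIso (hn : 1 < n) {K : ObjectProperty HeytAlg.{u}} (hK : IsVariety K)
    (hw : ∀ A : HeytAlg.{u}, K A → WidthAtMost n (DualSpace A)) {A : HeytAlg.{u}} (hA : K A)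
    (φ : XnInf.{u} n ≃o DualSpace A)
    (hφ : ∀ U : ClopenUpperSet (XnInf.{u} n), ∃ a : A, ∀ y, a ∈ (φ y).1 ↔ y ∈ U) :
    ¬ HasES K := by
  intro hES
  obtain ⟨B, f, hf, hrange⟩ := exists_saturated_subalgebra φ
  let B' : K.FullSubcategory := ⟨B, hK.of_injective hA f hf⟩
  let A' : K.FullSubcategory := ⟨A, hA⟩
  let ι : B' ⟶ A' := ObjectProperty.homMk (HeytAlg.ofHom f)
  have hepi : Epi ι := by
    refine ⟨fun {C} g h hgh => ?_⟩
    refine ObjectProperty.hom_ext _ (HeytAlg.ext fun a => ?_)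
    refine hom_eq_of_eqOn_saturated hn (hw _ C.property) φ hφ g.hom.hom h.hom.hom
      (fun a ha => ?_) a
    obtain ⟨b, rfl⟩ : a ∈ Set.range f := hrange ▸ ha
    exact congrArg (fun k : B' ⟶ C => k.hom b) hgh
  obtain ⟨U, hU⟩ := exists_not_saturated.{u} hn
  obtain ⟨a, ha⟩ := hφ U
  obtain ⟨b, hb⟩ := hES B' A' ι hepi a
  have hsat : a ∈ {a | Saturated {y | a ∈ (φ y).1}} := hrange ▸ ⟨b, hb⟩
  exact hU fun x y h => (ha x).symm.trans ((hsat h).trans (ha y))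

end XnInf

/-! ### Failure of the ES property. -/

theorem not_hasES_of_inDualClass {n : ℕ} (hn : 1 < n) {K : ObjectProperty HeytAlg.{u}}
    (hK : IsVariety K) (hw : ∀ A : HeytAlg.{u}, K A → WidthAtMost n (DualSpace A))
    (hX : InDualClass K (XnInf.{u} n)) : ¬ HasES K := by
  obtain ⟨A, hA, f, g, hgf, hfg⟩ := hX
  have hgf' : ∀ F, g (f F) = F := fun F => DFunLike.congr_fun hgf F
  have hfg' : ∀ y, f (g y) = y := fun y => DFunLike.congr_fun hfg y
  have hfm : Monotone f := f.monotone'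
  have hgm : Monotone g := g.monotone'
  have hfc : Continuous f := f.continuous_toFun
  have hgc : Continuous g := g.continuous_toFun
  -- Compactness is transported from `X_n^∞` along `g`; it is what makes every clopen upset come
  -- from an element of `A`.
  have : CompactSpace (DualSpace A) :=
    Function.Surjective.compactSpace (f := g) hgc (fun F => ⟨f F, hgf' F⟩)
  refine XnInf.not_hasES_of_orderIso hn hK hw hA
    { toFun := g
      invFun := f
      left_inv := hfg'
      right_inv := hgf'
      map_rel_iff' := ⟨fun h => by simpa [hfg'] using hfm h, fun h => hgm h⟩ } fun U => ?_
  obtain ⟨a, ha⟩ := DualSpace.exists_mem_iff_of_isClopen (U.isClopen.preimage hfc)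
    (U.upper.preimage hfm)
  refine ⟨a, fun y => (ha (g y)).trans ?_⟩
  rw [Set.mem_preimage, hfg', SetLike.mem_coe]

theorem not_hasES_of_between {n : ℕ} (hn : 1 < n) {K : ObjectProperty HeytAlg.{u}}
    (hK : IsVariety K) (hV : varietyGeneratedBy (dualAlgebra (XnInf.{u} n)) ≤ K)
    (hW : K ≤ W.{u} n) : ¬ HasES K :=
  XnInf.not_hasES_of_orderIso hn hK hW (hV _ fun _ _ h => h)
    (DualSpace.pointIso (X := XnInf.{u} n)) fun U => ⟨U, fun _ => Iff.rfl⟩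

end HeytES

theorem corollary6p6 (n : ℕ) (hn : 1 < n) :
    (∀ K : CategoryTheory.ObjectProperty HeytAlg.{u}, HeytES.IsVariety K →
      (∀ A : HeytAlg.{u}, K A → HeytES.WidthAtMost n (HeytES.DualSpace A)) →
      HeytES.InDualClass K (HeytES.XnInf.{u} n) → ¬ HeytES.HasES K) ∧
    HeytES.IsVariety (HeytES.W.{u} n) ∧
    HeytES.varietyGeneratedBy (HeytES.dualAlgebra (HeytES.XnInf.{u} n)) ≤ HeytES.W.{u} n ∧
    (∀ K : CategoryTheory.ObjectProperty HeytAlg.{u}, HeytES.IsVariety K →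
      HeytES.varietyGeneratedBy (HeytES.dualAlgebra (HeytES.XnInf.{u} n)) ≤ K →
      K ≤ HeytES.W.{u} n → ¬ HeytES.HasES K) ∧
    ¬ HeytES.HasES (HeytES.W.{u} n) :=
  ⟨fun _ hK hw hX => HeytES.not_hasES_of_inDualClass hn hK hw hX, HeytES.isVariety_W n,
    HeytES.varietyGeneratedBy_le_W hn,
    fun _ hK hV hW => HeytES.not_hasES_of_between hn hK hV hW,
    HeytES.not_hasES_of_between hn (HeytES.isVariety_W n) (HeytES.varietyGeneratedBy_le_W hn)
      le_rfl⟩
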